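/- Conventions. A manifold (topological, smooth or complex) is nonempty, Hausdorff, second countable, finite dimensional and of the same dimension at all of its points. A family of morphisms over an object $U$ is a set $r=\{r_i:U_i\to U\}$ of morphisms with codomain $U$. For a presheaf of sets $P$, a matching family over $r$ is a collection $x_i\in P(U_i)$ with $P(u_i)(x_i)=P(u_j)(x_j)$ whenever $r_iu_i=r_ju_j$; $P$ is a sheaf on $r$ if every matching family over $r$ is of the form $x_i=P(r_i)(x)$ for a unique $x\in P(U)$. Given a category $\mathcal C$ with a collection $j$ of covering families, $P$ is a $j$-sheaf if it is a sheaf on every $r\in j$. Let $\mathrm{Gro}(j)$ be the Grothendieck topology generated by $j$. For a presheaf of sets $A$ on $\mathcal C$ the plus construction is the presheaf $$A^+(U)=\operatorname*{colim}_{R\in \mathrm{Gro}(j)(U)^{op}}\mathrm{Pre}(\mathcal C)(R,A),$$ the colimit being over the covering sieves $R$ of $U$. An open covering family of a manifold $M$ is a family $\{r_i:U_i\to M\}$ of open embeddings (in the smooth and complex cases: immersions that are topological open embeddings) with $\bigcup_i r_i(U_i)=M$. Theorem. If $A$ is a presheaf of sets on any one of the following sites $(\mathcal C,j)$, then $A^+$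 is a $j$-sheaf: 1. $(\mathrm{TopMan},j_{\rm open})$: topological manifolds and continuous maps, with open covering families; 2. $(\mathcal O(X),j_X)$: the poset of nonempty open subsets of a paracompact Hausdorff space $X$ of finite covering dimension all of whose open subsets are paracompact, with open covers. (For an arbitrary paracompact Hausdorff space $X$ of finite covering dimension, $A^+$ is a sheaf on every open cover, by nonempty open sets, of every nonempty paracompact open subset $U\subseteq X$; in particular for $U=X$ if $X\neq\varnothing$.) 3. $(\mathrm{Man},j_{\rm open})$: smooth manifolds and smooth maps, with open covering families; 4. $(\mathrm{Cart},j_{\rm open})$: smooth manifolds diffeomorphic to some $\mathbb R^n$ and smooth maps, with open covering families by such manifolds; 5. $(\mathrm{Cart},j_{\rm good})$: the same category, with the families in 4 for which every nonempty finite intersection of the images is diffeomorphic to some $\mathbb R^n$; 6. $(\mathbb C\mathrm{Man},j_{\rm open})$: complex manifolds and holomorphic maps, with open covering families; 7. $(\mathrm{Stein},j_{\rm open})$: Stein manifolds (holomorphically convex complex manifolds whose holomorphic functions separate points) and holomorphic maps, with open covering families by Stein manifolds. -/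

import Mathlib

open CategoryTheory TopologicalSpace Manifold ContDiff Opposite

universe u v w

noncomputable section

namespace PlusSites

/-! ### Sheaves and the plus construction for a collection of covering families -/

section General

variable {C : Type u} [Category.{v} C]

/-- A presheaf of sets `P` is a sheaf for a collection `j` of covering families if, for every
family `r` in `j` over `U`, every matching family over `r` has a unique amalgamation. -/
def IsSheafOn (j : Precoverage C) (P : Cᵒᵖ ⥤ Type w) : Prop :=
  ∀ ⦃U : C⦄ ⦃r : Presieve U⦄, r ∈ j U → Presieve.IsSheafFor P r

/-- The plus construction `A⁺(U) = colim_R Hom(R, A)`, where `R` runs over the sieves on `U` that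
are covering for the Grothendieck topology generated by `j`. -/
def plus (j : Precoverage C) (A : Cᵒᵖ ⥤ Type (max u v w)) : Cᵒᵖ ⥤ Type (max u v w) :=
  j.toGrothendieck.plusObj A

end General

/-! ### The nonempty open subsets of a topological space -/

/-- The poset of nonempty open subsets of `X`, ordered by inclusion. -/
abbrev NonemptyOpens (X : Type u) [TopologicalSpace X] : Type u :=
  {U : Opens X // (U : Set X).Nonempty}

/-- The covering families of a nonempty open subset `U` are its open covers. -/
def openCovers (X : Type u) [TopologicalSpace X] : Precoverage (NonemptyOpens X) where
  coverings U := {r | ∀ x ∈ U.1, ∃ (V : NonemptyOpens X) (f : V ⟶ U), r f ∧ x ∈ V.1}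

/-- Every open cover of `X` has an open refinement such that any `n + 2` distinct members of it
have empty intersection. -/
def CoveringDimLE (X : Type u) [TopologicalSpace X] (n : ℕ) : Prop :=
  ∀ 𝒰 : Set (Opens X), sSup 𝒰 = ⊤ →
    ∃ 𝒱 : Set (Opens X), sSup 𝒱 = ⊤ ∧ (∀ V ∈ 𝒱, ∃ U ∈ 𝒰, V ≤ U) ∧
      ∀ s : Finset (Opens X), (s : Set (Opens X)) ⊆ 𝒱 → s.card = n + 2 → s.inf id = ⊥

def HasFiniteCoveringDim (X : Type u) [TopologicalSpace X] : Prop :=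
  ∃ n : ℕ, CoveringDimLE X n

/-! ### Topological manifolds -/

/-- Nonempty Hausdorff second countable spaces that are locally homeomorphic to `ℝⁿ`
for some fixed `n`. -/
def isTopMan : ObjectProperty TopCat.{u} := fun X =>
  Nonempty X ∧ T2Space X ∧ SecondCountableTopology X ∧
    ∃ n : ℕ, ∀ x : X, ∃ e : OpenPartialHomeomorph X (EuclideanSpace ℝ (Fin n)), x ∈ e.source

/-- The category of topological manifolds and continuous maps. -/
abbrev TopMan : Type (u + 1) := (isTopMan.{u}).FullSubcategory

/-- Jointly surjective families of open embeddings of topological manifolds. -/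
def topManOpen : Precoverage TopMan.{u} := TopCat.precoverage.comap (isTopMan.{u}).ι

/-! ### Smooth and complex manifolds -/

/-- Nonempty Hausdorff second countable `C^r`-manifolds over `𝕜`, of pure finite dimension. -/
structure Mfd (𝕜 : Type) [RCLike 𝕜] (r : WithTop ℕ∞) : Type (u + 1) where
  carrier : Type u
  dim : ℕ
  [topology : TopologicalSpace carrier]
  [charts : ChartedSpace (EuclideanSpace 𝕜 (Fin dim)) carrier]
  [isManifold : IsManifold 𝓘(𝕜, EuclideanSpace 𝕜 (Fin dim)) r carrier]
  [t2 : T2Space carrier]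
  [secondCountable : SecondCountableTopology carrier]
  [nonempty : Nonempty carrier]

namespace Mfd

variable {𝕜 : Type} [RCLike 𝕜] {r : WithTop ℕ∞}

instance : CoeSort (Mfd.{u} 𝕜 r) (Type u) := ⟨carrier⟩

attribute [instance] topology charts isManifold t2 secondCountable nonempty

/-- The model with corners (without boundary) of a manifold. -/
abbrev model (M : Mfd.{u} 𝕜 r) : ModelWithCorners 𝕜 (EuclideanSpace 𝕜 (Fin M.dim))
    (EuclideanSpace 𝕜 (Fin M.dim)) :=
  𝓘(𝕜, EuclideanSpace 𝕜 (Fin M.dim))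

/-- Morphisms are the `C^r` maps. -/
instance : Category.{u} (Mfd.{u} 𝕜 r) where
  Hom M N := ContMDiffMap M.model N.model M N r
  id _ := ContMDiffMap.id
  comp f g := g.comp f

/-- The map of underlying sets of a morphism. -/
def toFun {M N : Mfd.{u} 𝕜 r} (f : M ⟶ N) : M → N :=
  (show ContMDiffMap M.model N.model M N r from f)

/-- An open embedding is an immersion that is a homeomorphism onto an open subset. -/
def IsOpenEmb {M N : Mfd.{u} 𝕜 r} (f : M ⟶ N) : Prop :=
  Topology.IsOpenEmbedding (toFun f) ∧ IsImmersion M.model N.model r (toFun f)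

/-- Jointly surjective families of open embeddings. -/
def openFamilies (𝕜 : Type) [RCLike 𝕜] (r : WithTop ℕ∞) : Precoverage (Mfd.{u} 𝕜 r) where
  coverings M := {R | (∀ ⦃V : Mfd.{u} 𝕜 r⦄ (f : V ⟶ M), R f → IsOpenEmb f) ∧
    ∀ x : M, ∃ (V : Mfd.{u} 𝕜 r) (f : V ⟶ M), R f ∧ x ∈ Set.range (toFun f)}

end Mfd

/-- The category of smooth manifolds. -/
abbrev Man : Type (u + 1) := Mfd.{u} ℝ ∞

/-- The category of complex manifolds and holomorphic (i.e. complex analytic) maps. -/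
abbrev ComplexMan : Type (u + 1) := Mfd.{u} ℂ ω

/-! ### Cartesian spaces -/

/-- Smooth manifolds diffeomorphic to some `ℝⁿ`. -/
def isCart : ObjectProperty Man.{u} := fun M =>
  ∃ n : ℕ, Nonempty (Diffeomorph M.model (𝓡 n) M (EuclideanSpace ℝ (Fin n)) ∞)

/-- The category of cartesian spaces and smooth maps. -/
abbrev Cart : Type (u + 1) := (isCart.{u}).FullSubcategory

/-- Jointly surjective families of open embeddings of cartesian spaces. -/
def cartOpen : Precoverage Cart.{u} := (Mfd.openFamilies ℝ ∞).comap (isCart.{u}).ι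

/-- The image of some member of the family `r` is the open set `W`. -/
def IsImageOf {M : Cart.{u}} (r : Presieve M) (W : Opens M.obj) : Prop :=
  ∃ (V : Cart.{u}) (f : V ⟶ M), r f ∧ (W : Set M.obj) = Set.range (Mfd.toFun f.hom)

/-- Good open covers: open covering families of cartesian spaces such that every nonempty finite
intersection of (images of) members is diffeomorphic to some `ℝⁿ`. -/
def cartGood : Precoverage Cart.{u} where
  coverings M := {r | r ∈ cartOpen M ∧
    ∀ s : Finset (Opens M.obj), s.Nonempty → (∀ W ∈ s, IsImageOf r W) →
      ((s.inf id : Opens M.obj) : Set M.obj).Nonempty →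
        ∃ n : ℕ, Nonempty (Diffeomorph M.obj.model (𝓡 n) (s.inf id : Opens M.obj)
          (EuclideanSpace ℝ (Fin n)) ∞)}

/-! ### Stein manifolds -/

/-- The holomorphic functions on a complex manifold. -/
def IsHolo (M : ComplexMan.{u}) (f : M → ℂ) : Prop := ContMDiff M.model 𝓘(ℂ, ℂ) ω f

/-- The holomorphically convex hull of a subset `K`: the points `z` such that
`|f z| ≤ sup_K |f|` for all holomorphic functions `f`. -/
def holoHull (M : ComplexMan.{u}) (K : Set M) : Set M :=
  {z | ∀ f : M → ℂ, IsHolo M f → ∀ c : ℝ, (∀ x ∈ K, ‖f x‖ ≤ c) → ‖f z‖ ≤ c}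

/-- Stein manifolds: holomorphically convex and holomorphically separable complex manifolds. -/
def isStein : ObjectProperty ComplexMan.{u} := fun M =>
  (∀ K : Set M, IsCompact K → IsCompact (holoHull M K)) ∧
    ∀ x y : M, x ≠ y → ∃ f : M → ℂ, IsHolo M f ∧ f x ≠ f y

/-- The category of Stein manifolds and holomorphic maps. -/
abbrev Stein : Type (u + 1) := (isStein.{u}).FullSubcategory

/-- Jointly surjective families of open embeddings of Stein manifolds. -/
def steinOpen : Precoverage Stein.{u} := (Mfd.openFamilies ℂ ω).comap (isStein.{u}).ι

end PlusSites

end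

/-!
For a presheaf `A`, the presheaf `A⁺` is separated on every site, so the point is the existence of
amalgamations. A matching family in `A⁺` is represented locally by sections `a_α ∈ A(V_α)`, and two
of these agree in `A` only locally on the overlaps of their domains, with no uniform choice of
neighbourhoods. Godement's argument over a paracompact Hausdorff space repairs this. Choose a
locally finite refinement `v_α` of the `V_α` and open `v'_α` that still cover, with closure inside
`v_α`. Every point `x` lies in some `v'_α`, for `α = β(x)` say, and in the closures of only finitely
many `v'_α`. Hence it has a neighbourhood `O_x ⊆ v'_{β(x)}` that meets the closure of `v'_α` only if
`x` lies in it, and over which, in this case, `a_α` and `a_{β(x)}` agree. If `O_x` meets `O_y`, it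
meets `v'_{β(y)}`, so `a_{β(x)}` and `a_{β(y)}` agree over `O_x ∩ O_y`: the restrictions of the
`a_{β(x)}` to the `O_x` are a matching family in `A`, and define a section of `A⁺`.

`IsOpenEmbeddingSite` collects what this uses: objects have nonempty underlying spaces, covering
sieves are detected pointwise by open embeddings, maps lift along an open embedding that contains
their image, and every point of an object has arbitrarily small neighbourhoods in the site. Since
objects are nonempty, arrows into `O_x` and `O_y` with a common composite exist only if `O_x` and
`O_y` meet; the intersection itself need not be an object of the site. The argument itself is
`IsOpenEmbeddingSite.exists_isAmalgamation_plus`.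

It remains to see that the seven sites are of this kind. Lifts along immersive open embeddings are
smooth by the local normal form of immersions. For cartesian spaces the basis consists of the
inverse images of open boxes under a global chart; boxes are stable under intersection and
diffeomorphic to `ℝⁿ`, which makes these covers good (`isOpenEmbeddingSite_cartGood`). For complex
manifolds, coordinate balls are Stein (`isStein_of_range_eq_ball`), so that Stein manifolds have a
basis of Stein open subsets.
-/

universe t

noncomputable section

namespace PlusSites

/-! ### Sites of spaces with a basis of open embeddings -/

/-- The site `(C, j)` is one of nonempty spaces: `F` gives the underlying spaces, the morphisms in
`E` are open embeddings with the expected lifting property, they provide a neighbourhood basis of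
every point, and the families in `j` determine the same covering sieves as the pointwise covers
by morphisms in `E`. Intersections of open subsets are not assumed to come from objects of `C`, and
`E` is not assumed to be stable under composition. -/
structure IsOpenEmbeddingSite {C : Type u} [Category.{v} C] (j : Precoverage C)
    (F : C ⥤ TopCat.{t}) (E : MorphismProperty C) : Prop where
  isOpenEmbedding : ∀ {V U : C} (e : V ⟶ U), E e → Topology.IsOpenEmbedding (F.map e)
  mono : ∀ {V U : C} (e : V ⟶ U), E e → Mono e
  exists_lift : ∀ {V T U : C} (e : V ⟶ U) (g : T ⟶ U), E e →
    Set.range (F.map g) ⊆ Set.range (F.map e) → ∃ h : T ⟶ V, h ≫ e = g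
  nonempty : ∀ T : C, Nonempty (F.obj T)
  exists_subset : ∀ (U : C) (x : F.obj U) (O : Set (F.obj U)), IsOpen O → x ∈ O →
    ∃ (V : C) (e : V ⟶ U), E e ∧ x ∈ Set.range (F.map e) ∧ Set.range (F.map e) ⊆ O
  covers_of_mem : ∀ {U : C} (r : Presieve U), r ∈ j U → ∀ x : F.obj U,
    ∃ (V : C) (e : V ⟶ U), r e ∧ E e ∧ x ∈ Set.range (F.map e)
  exists_mem_of_covers : ∀ {U : C} (S : Sieve U),
    (∀ x : F.obj U, ∃ (V : C) (e : V ⟶ U), S e ∧ E e ∧ x ∈ Set.range (F.map e)) →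
    ∃ r ∈ j U, ∀ ⦃V : C⦄ (f : V ⟶ U), r f → S f

namespace IsOpenEmbeddingSite

variable {C : Type u} [Category.{v} C] {j : Precoverage C} {F : C ⥤ TopCat.{t}}
  {E : MorphismProperty C}

theorem range_comp_subset {T V U : C} (g : T ⟶ V) (e : V ⟶ U) :
    Set.range (F.map (g ≫ e)) ⊆ Set.range (F.map e) := by
  rintro _ ⟨y, rfl⟩
  exact ⟨F.map g y, by simp⟩

theorem isOpen_range_comp (h : IsOpenEmbeddingSite j F E) {W V U : C} {k : W ⟶ V} {e : V ⟶ U}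
    (hk : E k) (he : E e) : IsOpen (Set.range (F.map (k ≫ e))) := by
  rw [Functor.map_comp, TopCat.coe_comp]
  exact ((h.isOpenEmbedding e he).comp (h.isOpenEmbedding k hk)).isOpen_range

theorem exists_lift_comp (h : IsOpenEmbeddingSite j F E) {W V U T : C} {k : W ⟶ V} {e : V ⟶ U}
    (hk : E k) (he : E e) (g : T ⟶ U)
    (hg : Set.range (F.map g) ⊆ Set.range (F.map (k ≫ e))) : ∃ l : T ⟶ W, l ≫ k ≫ e = g := by
  obtain ⟨m, rfl⟩ := h.exists_lift e g he (hg.trans (range_comp_subset k e))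
  obtain ⟨l, rfl⟩ := h.exists_lift k m hk (by
    rintro _ ⟨y, rfl⟩
    obtain ⟨z, hz⟩ := hg ⟨y, rfl⟩
    exact ⟨z, (h.isOpenEmbedding e he).injective (by simpa using hz)⟩)
  exact ⟨l, (Category.assoc _ _ _).symm⟩

/-- Covering sieves are those that contain an embedding around every point. -/
theorem mem_toGrothendieck_iff (h : IsOpenEmbeddingSite j F E) {U : C} (S : Sieve U) :
    S ∈ j.toGrothendieck U ↔
      ∀ x : F.obj U, ∃ (V : C) (e : V ⟶ U), S e ∧ E e ∧ x ∈ Set.range (F.map e) := by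
  refine ⟨fun hS ↦ ?_, fun hS ↦ ?_⟩
  · rw [Precoverage.mem_toGrothendieck_iff] at hS
    induction hS with
    | of U r hr =>
      intro x
      obtain ⟨V, e, hre, he, hx⟩ := h.covers_of_mem r hr x
      exact ⟨V, e, Sieve.le_generate r _ _ hre, he, hx⟩
    | top U =>
      intro x
      obtain ⟨V, e, he, hx, -⟩ := h.exists_subset U x Set.univ isOpen_univ trivial
      exact ⟨V, e, trivial, he, hx⟩
    | pullback U S _ T g ih =>
      intro y
      obtain ⟨V, e, hSe, he, hy⟩ := ih (F.map g y)
      obtain ⟨W, e', he', hy', hsub⟩ := h.exists_subset T y (F.map g ⁻¹' Set.range (F.map e))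
        ((h.isOpenEmbedding e he).isOpen_range.preimage (F.map g).hom.continuous) hy
      obtain ⟨k, hk⟩ := h.exists_lift e (e' ≫ g) he (by
        rintro _ ⟨z, rfl⟩
        have := hsub ⟨z, rfl⟩
        simpa using this)
      refine ⟨W, e', ?_, he', hy'⟩
      rw [Sieve.pullback_apply, ← hk]
      exact S.downward_closed hSe k
    | transitive U S R _ _ ihS ihR =>
      intro x
      obtain ⟨V, e, hSe, he, y, rfl⟩ := ihS x
      obtain ⟨W, e', hRe', he', z, rfl⟩ := ihR hSe y
      obtain ⟨Z, e'', he'', hx, hsub⟩ := h.exists_subset U (F.map e (F.map e' z)) _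
        (h.isOpen_range_comp he' he) ⟨z, by simp⟩
      obtain ⟨l, rfl⟩ := h.exists_lift_comp he' he e'' hsub
      exact ⟨Z, _, R.downward_closed hRe' l, he'', hx⟩
  · obtain ⟨r, hr, hrS⟩ := h.exists_mem_of_covers S hS
    exact (j.toGrothendieck).superset_covering (Sieve.generate_le_iff _ _ |>.2 hrS)
      (Precoverage.generate_mem_toGrothendieck hr)

/-! ### Local sections of the plus construction -/

open GrothendieckTopology in
/-- Sections of `A` that become equal in `A⁺` are equal near every point. -/
theorem exists_map_eq_of_toPlus_eq (h : IsOpenEmbeddingSite j F E)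
    (A : Cᵒᵖ ⥤ Type (max u v w)) {U : C} (a b : A.obj (op U))
    (hab : (j.toGrothendieck.toPlus A).app (op U) a = (j.toGrothendieck.toPlus A).app (op U) b)
    (x : F.obj U) :
    ∃ (V : C) (e : V ⟶ U), E e ∧ x ∈ Set.range (F.map e) ∧ A.map e.op a = A.map e.op b := by
  rw [Plus.toPlus_eq_mk, Plus.toPlus_eq_mk, Plus.eq_mk_iff_exists] at hab
  obtain ⟨W, h1, h2, hW⟩ := hab
  obtain ⟨V, e, hWe, he, hx⟩ := (h.mem_toGrothendieck_iff W.1).1 W.2 x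
  exact ⟨V, e, he, hx, congr_arg (fun m : Meq A W ↦ m ⟨V, e, hWe⟩) hW⟩

/-- Two sections of `A` that agree in `A⁺` wherever both are defined already agree in `A` on all
objects over a small enough neighbourhood `N` of a given point. Since `A` need not be separated, `N`
depends on the two sections. -/
theorem exists_isOpen_forall_map_eq (h : IsOpenEmbeddingSite j F E)
    (A : Cᵒᵖ ⥤ Type (max u v w)) {U V V' : C} (f : V ⟶ U) (f' : V' ⟶ U) (hf : E f) (hf' : E f')
    (a : A.obj (op V)) (a' : A.obj (op V'))
    (haa' : ∀ {T : C} (g : T ⟶ V) (g' : T ⟶ V'), g ≫ f = g' ≫ f' →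
      (j.toGrothendieck.toPlus A).app (op T) (A.map g.op a) =
        (j.toGrothendieck.toPlus A).app (op T) (A.map g'.op a'))
    (x : F.obj U) (hx : x ∈ Set.range (F.map f)) (hx' : x ∈ Set.range (F.map f')) :
    ∃ N : Set (F.obj U), IsOpen N ∧ x ∈ N ∧ ∀ {T : C} (g : T ⟶ V) (g' : T ⟶ V'),
      g ≫ f = g' ≫ f' → Set.range (F.map (g ≫ f)) ⊆ N → A.map g.op a = A.map g'.op a' := by
  obtain ⟨Z, k, hk, ⟨z, rfl⟩, hsub⟩ := h.exists_subset U x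
    (Set.range (F.map f) ∩ Set.range (F.map f'))
    ((h.isOpenEmbedding f hf).isOpen_range.inter (h.isOpenEmbedding f' hf').isOpen_range)
    ⟨hx, hx'⟩
  obtain ⟨g₀, hg₀⟩ := h.exists_lift f k hf (hsub.trans Set.inter_subset_left)
  obtain ⟨g₀', hg₀'⟩ := h.exists_lift f' k hf' (hsub.trans Set.inter_subset_right)
  obtain ⟨Y, e, he, hz, hee⟩ := h.exists_map_eq_of_toPlus_eq A _ _
    (haa' g₀ g₀' (by rw [hg₀, hg₀'])) z
  refine ⟨_, h.isOpen_range_comp he hk, ?_, fun {T} g g' hgg' hr ↦ ?_⟩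
  · obtain ⟨y, rfl⟩ := hz
    exact ⟨y, by simp⟩
  obtain ⟨l, hl⟩ := h.exists_lift_comp he hk (g ≫ f) hr
  have := h.mono f hf
  have := h.mono f' hf'
  have h1 : g = (l ≫ e) ≫ g₀ := by rw [← cancel_mono f, Category.assoc, hg₀, Category.assoc, hl]
  have h2 : g' = (l ≫ e) ≫ g₀' := by
    rw [← cancel_mono f', Category.assoc, hg₀', Category.assoc, hl, hgg']
  rw [h1, h2]
  simp only [op_comp, Functor.map_comp, types_comp_apply] at hee ⊢
  rw [hee]

open GrothendieckTopology in
/-- The first half of the sheaf condition holds on every site: `A⁺` is separated. -/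
theorem isSeparatedFor_plus {U : C} (r : Presieve U) (hr : r ∈ j U)
    (A : Cᵒᵖ ⥤ Type (max u v w)) : Presieve.IsSeparatedFor (plus.{u, v, w} j A) r := by
  intro s t₁ t₂ h₁ h₂
  refine Plus.sep (J := j.toGrothendieck) A
    ⟨Sieve.generate r, Precoverage.generate_mem_toGrothendieck hr⟩ t₁ t₂ ?_
  rintro ⟨Y, f, V, g, e, he, rfl⟩
  have := (h₁ e he).trans (h₂ e he).symm
  have := congr_arg ((plus.{u, v, w} j A).map g.op) this
  simp only [op_comp, Functor.map_comp]
  exact this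

open GrothendieckTopology in
/-- Locally, sections of `A⁺` come from `A`. -/
theorem exists_toPlus_eq (h : IsOpenEmbeddingSite j F E) (A : Cᵒᵖ ⥤ Type (max u v w)) {U : C}
    (s : (plus.{u, v, w} j A).obj (op U)) (x : F.obj U) :
    ∃ (V : C) (e : V ⟶ U) (a : A.obj (op V)), E e ∧ x ∈ Set.range (F.map e) ∧
      (plus.{u, v, w} j A).map e.op s = (j.toGrothendieck.toPlus A).app (op V) a := by
  obtain ⟨S, y, rfl⟩ := Plus.exists_rep (J := j.toGrothendieck) (P := A) s
  obtain ⟨V, e, hSe, he, hx⟩ := (h.mem_toGrothendieck_iff S.1).1 S.2 x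
  exact ⟨V, e, y ⟨V, e, hSe⟩, he, hx, (Plus.toPlus_apply S y ⟨V, e, hSe⟩).symm⟩

end IsOpenEmbeddingSite

/-! ### Gluing over paracompact spaces -/

open GrothendieckTopology in
/-- A compatible family of sections of `A` over a covering family glues to a section of `A⁺`. -/
theorem exists_map_eq_toPlus {C : Type u} [Category.{v} C] {j : Precoverage C}
    (A : Cᵒᵖ ⥤ Type (max u v w)) {U : C} {ι : Type*} (W : ι → C)
    (p : ∀ i, W i ⟶ U) (hp : Sieve.ofArrows W p ∈ j.toGrothendieck U)
    (b : ∀ i, A.obj (op (W i)))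
    (hb : ∀ (i i' : ι) (T : C) (g : T ⟶ W i) (g' : T ⟶ W i'), g ≫ p i = g' ≫ p i' →
      A.map g.op (b i) = A.map g'.op (b i')) :
    ∃ t : (plus.{u, v, w} j A).obj (op U), ∀ i,
      (plus.{u, v, w} j A).map (p i).op t = (j.toGrothendieck.toPlus A).app (op (W i)) (b i) := by
  let S : j.toGrothendieck.Cover U := ⟨Sieve.ofArrows W p, hp⟩
  have hS : ∀ I : S.Arrow, ∃ (i : ι) (g : I.Y ⟶ W i), g ≫ p i = I.f := by
    rintro ⟨Y, f, V, g, _, ⟨i⟩, rfl⟩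
    exact ⟨i, g, rfl⟩
  choose i g hg using hS
  let m : Meq A S := ⟨fun I ↦ A.map (g I).op (b (i I)), fun I ↦ by
    have := hb _ _ _ (I.r.g₁ ≫ g I.fst) (I.r.g₂ ≫ g I.snd) (by
      rw [Category.assoc, Category.assoc, hg, hg, I.r.w])
    simpa using this⟩
  refine ⟨Plus.mk m, fun k ↦ ?_⟩
  let I : S.Arrow := ⟨W k, p k, Sieve.ofArrows_mk W p k⟩
  refine (Plus.toPlus_apply S m I).symm.trans ?_
  congr 1
  refine (hb _ _ _ (g I) (𝟙 _) (by rw [hg, Category.id_comp])).trans ?_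
  simp [I]

namespace IsOpenEmbeddingSite

variable {C : Type u} [Category.{v} C] {j : Precoverage C} {F : C ⥤ TopCat.{t}}
  {E : MorphismProperty C}

/-- Godement's gluing argument: the local representatives in `A` of a matching family in `A⁺`
agree only locally on overlaps, and a locally finite shrinking of their domains turns them into a
matching family in `A` over a finer cover. -/
theorem exists_isAmalgamation_plus (h : IsOpenEmbeddingSite j F E)
    (A : Cᵒᵖ ⥤ Type (max u v w)) {U : C} [T2Space (F.obj U)] [ParacompactSpace (F.obj U)]
    (S : Sieve U) (hS : S ∈ j.toGrothendieck U)
    (s : Presieve.FamilyOfElements (plus.{u, v, w} j A) S.arrows) (hs : s.SieveCompatible) :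
    ∃ t, s.IsAmalgamation t := by
  -- Around every point `x`, the family `s` is represented by some `a x` on the domain of `f x`.
  have hloc : ∀ x : F.obj U, ∃ (V : C) (f : V ⟶ U) (hf : S f) (a : A.obj (op V)), E f ∧
      x ∈ Set.range (F.map f) ∧ s f hf = (j.toGrothendieck.toPlus A).app (op V) a := by
    intro x
    obtain ⟨V, f, hSf, hf, y, rfl⟩ := (h.mem_toGrothendieck_iff S).1 hS x
    obtain ⟨W, e, a, he, hy, hea⟩ := h.exists_toPlus_eq A (s f hSf) y
    obtain ⟨Z, k, hk, hx, hsub⟩ := h.exists_subset U (F.map f y) _ (h.isOpen_range_comp he hf) (by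
      obtain ⟨w, rfl⟩ := hy
      exact ⟨w, by simp⟩)
    obtain ⟨m, rfl⟩ := h.exists_lift_comp he hf k hsub
    rw [← Category.assoc] at hk hx
    refine ⟨Z, (m ≫ e) ≫ f, S.downward_closed hSf _, A.map m.op a, hk, hx, ?_⟩
    rw [hs _ _ hSf, op_comp, Functor.map_comp, ConcreteCategory.comp_apply, hea]
    exact (NatTrans.naturality_apply (j.toGrothendieck.toPlus A) m.op a).symm
  choose V f hSf a hf hfx hsa using hloc
  have hsf : ∀ (γ : F.obj U) {T : C} (k : T ⟶ V γ),
      (j.toGrothendieck.toPlus A).app (op T) (A.map k.op (a γ)) =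
        s (k ≫ f γ) (S.downward_closed (hSf γ) k) := fun γ T k ↦ by
    rw [hs _ _ (hSf γ), hsa]
    exact NatTrans.naturality_apply (j.toGrothendieck.toPlus A) k.op (a γ)
  have htoPlus : ∀ (α β : F.obj U) {T : C} (g : T ⟶ V α) (g' : T ⟶ V β), g ≫ f α = g' ≫ f β →
      (j.toGrothendieck.toPlus A).app (op T) (A.map g.op (a α)) =
        (j.toGrothendieck.toPlus A).app (op T) (A.map g'.op (a β)) := by
    intro α β T g g' hgg'
    rw [hsf, hsf]
    congr 1
  -- A locally finite refinement `v` and its shrinking `v'` need not consist of objects of `C`.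
  obtain ⟨v, hvo, hvc, hvlf, hvs⟩ := precise_refinement (fun α ↦ Set.range (F.map (f α)))
    (fun α ↦ (h.isOpenEmbedding _ (hf α)).isOpen_range)
    (Set.eq_univ_of_forall fun x ↦ Set.mem_iUnion.2 ⟨x, hfx x⟩)
  obtain ⟨v', hv'c, hv'o, hv's⟩ := exists_iUnion_eq_closure_subset hvo
    (fun x ↦ hvlf.point_finite x) hvc
  have hclf : LocallyFinite fun α ↦ closure (v' α) := hvlf.subset hv's
  -- `N x α β` is a neighbourhood of `x` over which `a α` and `a β` agree, if `x` lies in the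
  -- closure of `v' α` and in `v' β`.
  have hN : ∀ (x : F.obj U) (α β : F.obj U), ∃ N ∈ nhds x,
      x ∈ closure (v' α) → x ∈ v' β → ∀ {T : C} (g : T ⟶ V α) (g' : T ⟶ V β),
        g ≫ f α = g' ≫ f β → Set.range (F.map (g ≫ f α)) ⊆ N →
          A.map g.op (a α) = A.map g'.op (a β) := by
    intro x α β
    by_cases hx : x ∈ closure (v' α) ∧ x ∈ v' β
    · obtain ⟨N, hNo, hxN, hN⟩ := h.exists_isOpen_forall_map_eq A (f α) (f β) (hf α) (hf β)
        (a α) (a β) (htoPlus α β) x (hvs α (hv's α hx.1)) (hvs β (hv's β (subset_closure hx.2)))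
      exact ⟨N, hNo.mem_nhds hxN, fun _ _ ↦ hN⟩
    · exact ⟨Set.univ, Filter.univ_mem, fun h1 h2 ↦ (hx ⟨h1, h2⟩).elim⟩
  choose N hNmem hN using hN
  have hβ : ∀ x : F.obj U, ∃ β, x ∈ v' β := fun x ↦ Set.mem_iUnion.1 (hv'c ▸ Set.mem_univ x)
  choose β hβ using hβ
  -- `O x` is so small that it meets the closure of `v' α` only if `x` lies in it, and that, for
  -- these finitely many `α`, the section `a α` agrees with `a (β x)` over it.
  have hO : ∀ x : F.obj U, ∃ O : Set (F.obj U), IsOpen O ∧ x ∈ O ∧ O ⊆ v' (β x) ∧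
      ∀ α, (O ∩ closure (v' α)).Nonempty → x ∈ closure (v' α) ∧ O ⊆ N x α (β x) := by
    intro x
    have h1 := hclf.iInter_compl_mem_nhds (fun _ ↦ isClosed_closure) x
    have h2 : ⋂ α ∈ {α | x ∈ closure (v' α)}, N x α (β x) ∈ nhds x :=
      (Filter.biInter_mem (hclf.point_finite x)).2 fun α _ ↦ hNmem x α (β x)
    have h3 := (hv'o (β x)).mem_nhds (hβ x)
    obtain ⟨O, hOs, hOo, hxO⟩ := mem_nhds_iff.1 (Filter.inter_mem (Filter.inter_mem h1 h2) h3)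
    refine ⟨O, hOo, hxO, fun y hy ↦ (hOs hy).2, fun α ⟨y, hyO, hyα⟩ ↦ ?_⟩
    have hxα : x ∈ closure (v' α) := by
      by_contra hx
      exact Set.mem_iInter₂.1 (hOs hyO).1.1 α hx hyα
    exact ⟨hxα, fun z hz ↦ Set.mem_iInter₂.1 (hOs hz).1.2 α hxα⟩
  choose O hOo hxO hOv hO using hO
  -- The finer cover: an object `W x` within `O x`, with the restriction of `a (β x)` as section.
  have hW : ∀ x : F.obj U, ∃ (W : C) (p : W ⟶ U) (q : W ⟶ V (β x)), E p ∧
      x ∈ Set.range (F.map p) ∧ Set.range (F.map p) ⊆ O x ∧ q ≫ f (β x) = p := by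
    intro x
    obtain ⟨W, p, hp, hx, hsub⟩ := h.exists_subset U x (O x) (hOo x) (hxO x)
    obtain ⟨q, hq⟩ := h.exists_lift (f (β x)) p (hf _)
      (hsub.trans <| (hOv x).trans <| subset_closure.trans <| (hv's _).trans (hvs _))
    exact ⟨W, p, q, hp, hx, hsub, hq⟩
  choose W p q hp hpx hpO hq using hW
  have hR : Sieve.ofArrows W p ∈ j.toGrothendieck U :=
    (h.mem_toGrothendieck_iff _).2 fun x ↦ ⟨W x, p x, Sieve.ofArrows_mk W p x, hp x, hpx x⟩
  obtain ⟨t, ht⟩ := exists_map_eq_toPlus A W p hR (fun x ↦ A.map (q x).op (a (β x))) (by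
    -- As `T` is nonempty, `O x` meets `O y ⊆ v' (β y)`; hence `a (β y)` and `a (β x)` agree over
    -- `O x`.
    intro x y T g g' hgg'
    obtain ⟨z⟩ := h.nonempty T
    have hz : F.map (g' ≫ p y) z ∈ O x :=
      hgg' ▸ hpO x (range_comp_subset g (p x) ⟨z, rfl⟩)
    have hz' : F.map (g' ≫ p y) z ∈ closure (v' (β y)) :=
      subset_closure (hOv y (hpO y (range_comp_subset g' (p y) ⟨z, rfl⟩)))
    obtain ⟨hx, hON⟩ := hO x (β y) ⟨_, hz, hz'⟩
    have := hN x (β y) (β x) hx (hβ x) (g' ≫ q y) (g ≫ q x)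
      (by rw [Category.assoc, Category.assoc, hq, hq, hgg'])
      (by
        rw [Category.assoc, hq, ← hgg']
        exact (range_comp_subset g (p x)).trans ((hpO x).trans hON))
    simpa using this.symm)
  refine ⟨t, fun Y k hk ↦ ?_⟩
  -- `A⁺` is separated, so the two sections may be compared on the members of the finer cover.
  refine GrothendieckTopology.Plus.sep (J := j.toGrothendieck) A
    ⟨(Sieve.ofArrows W p).pullback k, j.toGrothendieck.pullback_stable k hR⟩ _ _ ?_
  rintro ⟨Z, g, Wx, m, _, ⟨x⟩, hm⟩
  have h₁ : (plus j A).map g.op ((plus j A).map k.op t) =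
      (plus j A).map m.op ((plus j A).map (p x).op t) := by
    rw [← ConcreteCategory.comp_apply, ← ConcreteCategory.comp_apply, ← Functor.map_comp,
      ← Functor.map_comp, ← op_comp, ← op_comp, hm]
  have h₂ : (plus j A).map m.op ((plus j A).map (p x).op t) =
      (j.toGrothendieck.toPlus A).app (op Z) (A.map (m ≫ q x).op (a (β x))) := by
    rw [ht, op_comp, Functor.map_comp, ConcreteCategory.comp_apply]
    exact (NatTrans.naturality_apply (j.toGrothendieck.toPlus A) m.op _).symm
  have h₃ : s ((m ≫ q x) ≫ f (β x)) (S.downward_closed (hSf _) _) =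
      s (g ≫ k) (S.downward_closed hk g) := by
    congr 1
    rw [Category.assoc, hq, hm]
  exact h₁.trans (h₂.trans ((hsf _ _).trans (h₃.trans (hs k g hk))))

/-- `A⁺` satisfies the sheaf condition for the covers of paracompact Hausdorff objects. -/
theorem isSheafFor_plus (h : IsOpenEmbeddingSite j F E)
    (A : Cᵒᵖ ⥤ Type (max u v w)) {U : C} [T2Space (F.obj U)] [ParacompactSpace (F.obj U)]
    (r : Presieve U) (hr : r ∈ j U) :
    Presieve.IsSheafFor (plus.{u, v, w} j A) r := by
  rw [← Presieve.isSeparatedFor_and_exists_isAmalgamation_iff_isSheafFor]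
  refine ⟨isSeparatedFor_plus r hr A, fun s hs ↦ ?_⟩
  obtain ⟨t, ht⟩ := h.exists_isAmalgamation_plus A (Sieve.generate r)
    (Precoverage.generate_mem_toGrothendieck hr) s.sieveExtend
    ((Presieve.compatible_iff_sieveCompatible _).1 hs.sieveExtend)
  refine ⟨t, fun Y f hf ↦ ?_⟩
  rw [ht f (Sieve.le_generate r _ _ hf), Presieve.extend_agrees hs hf]

end IsOpenEmbeddingSite

/-! ### The poset of nonempty open subsets -/

/-- The functor sending a nonempty open subset to itself, as a topological space. -/
def nonemptyOpensToTopCat (X : Type u) [TopologicalSpace X] : NonemptyOpens X ⥤ TopCat.{u} where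
  obj U := TopCat.of U.1
  map f := TopCat.ofHom ⟨Set.inclusion (leOfHom f), continuous_inclusion (leOfHom f)⟩

theorem range_nonemptyOpensToTopCat_map {X : Type u} [TopologicalSpace X] {U V : NonemptyOpens X}
    (f : V ⟶ U) : Set.range ((nonemptyOpensToTopCat X).map f) = {x : U.1 | x.1 ∈ V.1} :=
  Set.range_inclusion (leOfHom f)

theorem isOpenEmbeddingSite_nonemptyOpens (X : Type u) [TopologicalSpace X] :
    IsOpenEmbeddingSite (openCovers X) (nonemptyOpensToTopCat X) ⊤ where
  isOpenEmbedding {V U} e _ := Opens.isOpenEmbedding_of_le (leOfHom e)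
  mono e _ := ⟨fun _ _ _ ↦ Subsingleton.elim _ _⟩
  exists_lift {V T U} e g _ hge := by
    refine ⟨homOfLE fun x hx ↦ ?_, Subsingleton.elim _ _⟩
    rw [range_nonemptyOpensToTopCat_map, range_nonemptyOpensToTopCat_map] at hge
    exact @hge ⟨x, leOfHom g hx⟩ hx
  nonempty T := T.2.to_subtype
  exists_subset U x O hO hx := by
    have hO' : IsOpen (Subtype.val '' O) := U.1.isOpen.isOpenEmbedding_subtypeVal.isOpenMap O hO
    let V : NonemptyOpens X := ⟨⟨_, hO'⟩, x.1, x, hx, rfl⟩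
    have hVU : V ≤ U := by
      rintro _ ⟨y, -, rfl⟩
      exact y.2
    refine ⟨V, homOfLE hVU, trivial, ?_, ?_⟩
    · rw [range_nonemptyOpensToTopCat_map]
      exact ⟨x, hx, rfl⟩
    · rw [range_nonemptyOpensToTopCat_map]
      rintro y ⟨z, hz, hzy⟩
      exact Subtype.ext hzy ▸ hz
  covers_of_mem {U} r hr x := by
    obtain ⟨V, f, hf, hx⟩ := hr x.1 x.2
    exact ⟨V, f, hf, trivial, by rw [range_nonemptyOpensToTopCat_map]; exact hx⟩
  exists_mem_of_covers {U} S hS := by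
    refine ⟨S.arrows, fun x hx ↦ ?_, fun V f hf ↦ hf⟩
    obtain ⟨V, f, hf, -, hxV⟩ := hS ⟨x, hx⟩
    rw [range_nonemptyOpensToTopCat_map] at hxV
    exact ⟨V, f, hf, hxV⟩

/-! ### Topological manifolds -/

theorem mem_topManOpen_iff {M : TopMan.{u}} (r : Presieve M) :
    r ∈ topManOpen M ↔ (∀ x : M.obj, ∃ (V : TopMan.{u}) (f : V ⟶ M), r f ∧
      x ∈ Set.range f.hom) ∧ ∀ ⦃V : TopMan.{u}⦄ (f : V ⟶ M), r f →
        Topology.IsOpenEmbedding f.hom := by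
  rw [topManOpen, Precoverage.mem_comap_iff]
  constructor
  · rintro ⟨h1, h2⟩
    refine ⟨fun x ↦ ?_, fun V f hf ↦ h2 (Presieve.map_map hf)⟩
    obtain ⟨_, _, ⟨⟨hf⟩⟩, hx⟩ := h1 x
    exact ⟨_, _, hf, hx⟩
  · rintro ⟨h1, h2⟩
    refine ⟨fun x ↦ ?_, ?_⟩
    · obtain ⟨V, f, hf, hx⟩ := h1 x
      exact ⟨_, _, ⟨Presieve.map_map hf⟩, hx⟩
    · rintro _ _ ⟨hf⟩
      exact h2 _ hf

theorem isTopMan_opens {X : TopCat.{u}} (hX : isTopMan X) (O : Opens X)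
    (hO : (O : Set X).Nonempty) : isTopMan (TopCat.of O) := by
  obtain ⟨-, _, _, n, hn⟩ := hX
  refine ⟨hO.to_subtype, inferInstanceAs (T2Space O),
    inferInstanceAs (SecondCountableTopology O), n, fun x ↦ ?_⟩
  obtain ⟨e, hx⟩ := hn x.1
  exact ⟨e.subtypeRestr ⟨x⟩, by simpa using hx⟩

theorem paracompactSpace_of_isTopMan {X : TopCat.{u}} (hX : isTopMan X) : ParacompactSpace X := by
  obtain ⟨-, _, _, n, hn⟩ := hX
  choose e he using hn
  let _ : ChartedSpace (EuclideanSpace ℝ (Fin n)) X :=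
    { atlas := Set.range e
      chartAt := e
      mem_chart_source := he
      chart_mem_atlas := fun x ↦ ⟨x, rfl⟩ }
  have := ChartedSpace.locallyCompactSpace (EuclideanSpace ℝ (Fin n)) X
  infer_instance

theorem isOpenEmbeddingSite_topMan :
    IsOpenEmbeddingSite topManOpen.{u} isTopMan.{u}.ι
      (TopCat.isOpenEmbedding.inverseImage isTopMan.{u}.ι) where
  isOpenEmbedding e he := he
  mono e he := by
    have : Mono (isTopMan.ι.map e) :=
      (TopCat.mono_iff_injective _).2
        (Topology.IsEmbedding.injective (Topology.IsOpenEmbedding.toIsEmbedding he))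
    exact isTopMan.ι.mono_of_mono_map this
  exists_lift {V T U} e g he hge := by
    have he' : Topology.IsOpenEmbedding e.hom := he
    choose k hk using fun x ↦ hge ⟨x, rfl⟩
    have hkc : Continuous k := he'.continuous_iff.2
      ((funext hk : e.hom ∘ k = g.hom) ▸ g.hom.hom.continuous)
    refine ⟨ObjectProperty.homMk (TopCat.ofHom ⟨k, hkc⟩), ?_⟩
    ext x
    exact hk x
  nonempty T := T.2.1
  exists_subset U x O hO hx := by
    refine ⟨⟨TopCat.of (⟨O, hO⟩ : Opens U.obj), isTopMan_opens U.2 ⟨O, hO⟩ ⟨x, hx⟩⟩,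
      ObjectProperty.homMk (TopCat.ofHom ⟨Subtype.val, continuous_subtype_val⟩),
      hO.isOpenEmbedding_subtypeVal, ⟨⟨x, hx⟩, rfl⟩, ?_⟩
    rintro _ ⟨y, rfl⟩
    exact y.2
  covers_of_mem {U} r hr x := by
    rw [mem_topManOpen_iff] at hr
    obtain ⟨V, f, hf, hx⟩ := hr.1 x
    exact ⟨V, f, hf, hr.2 f hf, hx⟩
  exists_mem_of_covers {U} S hS := by
    refine ⟨fun V f ↦ S f ∧ Topology.IsOpenEmbedding f.hom, ?_, fun V f hf ↦ hf.1⟩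
    rw [mem_topManOpen_iff]
    refine ⟨fun x ↦ ?_, fun V f hf ↦ hf.2⟩
    obtain ⟨V, f, hf, hf', hx⟩ := hS x
    exact ⟨V, f, ⟨hf, hf'⟩, hx⟩

/-! ### Smooth and complex manifolds -/

namespace Mfd

variable {𝕜 : Type} [RCLike 𝕜] {r : WithTop ℕ∞}

theorem contMDiff_toFun {M N : Mfd.{u} 𝕜 r} (f : M ⟶ N) :
    ContMDiff M.model N.model r (toFun f) :=
  ContMDiffMap.contMDiff (show ContMDiffMap M.model N.model M N r from f)

theorem hom_ext {M N : Mfd.{u} 𝕜 r} {f g : M ⟶ N} (h : ∀ x, toFun f x = toFun g x) : f = g :=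
  ContMDiffMap.ext h

/-- The morphism given by a `C^r` map. -/
def homMk {M N : Mfd.{u} 𝕜 r} (f : M → N) (hf : ContMDiff M.model N.model r f) : M ⟶ N :=
  show ContMDiffMap M.model N.model M N r from ⟨f, hf⟩

/-- The underlying topological space of a manifold. -/
def toTopCat (𝕜 : Type) [RCLike 𝕜] (r : WithTop ℕ∞) : Mfd.{u} 𝕜 r ⥤ TopCat.{u} where
  obj M := TopCat.of M
  map f := TopCat.ofHom ⟨toFun f, (contMDiff_toFun f).continuous⟩

instance (M : Mfd.{u} 𝕜 r) : ParacompactSpace M := by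
  have := ChartedSpace.locallyCompactSpace (EuclideanSpace 𝕜 (Fin M.dim)) M
  infer_instance

/-- A nonempty open subset of a manifold, as a manifold. -/
def opens (M : Mfd.{u} 𝕜 r) (O : Opens M) (hO : (O : Set M).Nonempty) : Mfd.{u} 𝕜 r :=
  have := hO.to_subtype
  { carrier := O
    dim := M.dim }

/-- The inclusion of an open submanifold. -/
def opensι (M : Mfd.{u} 𝕜 r) (O : Opens M) (hO : (O : Set M).Nonempty) : M.opens O hO ⟶ M :=
  homMk (M := M.opens O hO) (Subtype.val : O → M)
    (show ContMDiff M.model M.model r (Subtype.val : O → M) from contMDiff_subtype_val)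

theorem isOpenEmb_opensι (M : Mfd.{u} 𝕜 r) (O : Opens M) (hO : (O : Set M).Nonempty) :
    IsOpenEmb (M.opensι O hO) :=
  ⟨O.isOpen.isOpenEmbedding_subtypeVal,
    show IsImmersion M.model M.model r (Subtype.val : O → M) from IsImmersion.of_opens O⟩

theorem range_opensι (M : Mfd.{u} 𝕜 r) (O : Opens M) (hO : (O : Set M).Nonempty) :
    Set.range (toFun (M.opensι O hO)) = O :=
  Subtype.range_coe

/-- The local normal form of immersions makes lifts along open embeddings `C^r`. -/
theorem exists_lift {V T U : Mfd.{u} 𝕜 r} (e : V ⟶ U) (g : T ⟶ U) (he : IsOpenEmb e)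
    (hge : Set.range (toFun g) ⊆ Set.range (toFun e)) : ∃ h : T ⟶ V, h ≫ e = g := by
  choose k hk using fun x ↦ hge ⟨x, rfl⟩
  have hkc : Continuous k := he.1.continuous_iff.2
    ((funext hk : toFun e ∘ k = toFun g) ▸ (contMDiff_toFun g).continuous)
  have hks : ContMDiff T.model V.model r k := (ContMDiff.iff_comp_isImmersion he.2).2
    ⟨hkc, (funext hk : toFun e ∘ k = toFun g) ▸ contMDiff_toFun g⟩
  exact ⟨homMk k hks, hom_ext hk⟩

end Mfd

open Mfd

/-- For a full subcategory of manifolds it is enough that the points of its objects have arbitrarily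
small neighbourhoods in it, and that every cover by open embeddings is refined by one in `j`. -/
theorem isOpenEmbeddingSite_of_fullyFaithful {𝕜 : Type} [RCLike 𝕜] {r : WithTop ℕ∞} {C : Type u}
    [Category.{v} C] (ι : C ⥤ Mfd.{t} 𝕜 r) [ι.Full] [ι.Faithful] (j : Precoverage C)
    (hbasis : ∀ (U : C) (x : ι.obj U) (O : Set (ι.obj U)), IsOpen O → x ∈ O →
      ∃ (V : C) (e : V ⟶ U), IsOpenEmb (ι.map e) ∧ x ∈ Set.range (toFun (ι.map e)) ∧
        Set.range (toFun (ι.map e)) ⊆ O)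
    (hj : j ≤ (openFamilies 𝕜 r).comap ι)
    (hjmem : ∀ {U : C} (S : Sieve U),
      (∀ x : ι.obj U, ∃ (V : C) (e : V ⟶ U), S e ∧ IsOpenEmb (ι.map e) ∧
        x ∈ Set.range (toFun (ι.map e))) →
      ∃ R ∈ j U, ∀ ⦃V : C⦄ (f : V ⟶ U), R f → S f) :
    IsOpenEmbeddingSite j (ι ⋙ toTopCat 𝕜 r) (fun _ _ f ↦ IsOpenEmb (ι.map f)) where
  isOpenEmbedding e he := he.1
  mono e he := by
    have : Mono (ι.map e) :=
      ⟨fun a b hab ↦ hom_ext fun x ↦ he.1.injective (congr_arg (fun f ↦ toFun f x) hab)⟩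
    exact ι.mono_of_mono_map this
  exists_lift e g he hge := by
    obtain ⟨k, hk⟩ := Mfd.exists_lift (ι.map e) (ι.map g) he hge
    exact ⟨ι.preimage k, ι.map_injective (by simpa using hk)⟩
  nonempty T := (ι.obj T).nonempty
  exists_subset := hbasis
  covers_of_mem {U} R hR x := by
    obtain ⟨h1, h2⟩ := hj U hR
    obtain ⟨_, _, ⟨hf⟩, hx⟩ := h2 x
    exact ⟨_, _, hf, h1 _ (Presieve.map_map hf), hx⟩
  exists_mem_of_covers := hjmem

theorem isOpenEmbeddingSite_comap_openFamilies {𝕜 : Type} [RCLike 𝕜] {r : WithTop ℕ∞} {C : Type u}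
    [Category.{v} C] (ι : C ⥤ Mfd.{t} 𝕜 r) [ι.Full] [ι.Faithful]
    (hbasis : ∀ (U : C) (x : ι.obj U) (O : Set (ι.obj U)), IsOpen O → x ∈ O →
      ∃ (V : C) (e : V ⟶ U), IsOpenEmb (ι.map e) ∧ x ∈ Set.range (toFun (ι.map e)) ∧
        Set.range (toFun (ι.map e)) ⊆ O) :
    IsOpenEmbeddingSite ((openFamilies 𝕜 r).comap ι) (ι ⋙ toTopCat 𝕜 r)
      (fun _ _ f ↦ IsOpenEmb (ι.map f)) := by
  refine isOpenEmbeddingSite_of_fullyFaithful ι _ hbasis le_rfl fun {U} S hS ↦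
    ⟨fun V f ↦ S f ∧ IsOpenEmb (ι.map f), ⟨?_, fun x ↦ ?_⟩, fun V f hf ↦ hf.1⟩
  · rintro _ _ ⟨hf⟩
    exact hf.2
  · obtain ⟨V, f, hf, hf', hx⟩ := hS x
    exact ⟨_, _, Presieve.map_map ⟨hf, hf'⟩, hx⟩

theorem isOpenEmbeddingSite_openFamilies (𝕜 : Type) [RCLike 𝕜] (r : WithTop ℕ∞) :
    IsOpenEmbeddingSite (openFamilies.{u} 𝕜 r) (𝟭 _ ⋙ toTopCat 𝕜 r)
      (fun _ _ f ↦ IsOpenEmb f) :=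
  Precoverage.comap_id (openFamilies.{u} 𝕜 r) ▸
    isOpenEmbeddingSite_comap_openFamilies (𝟭 (Mfd.{u} 𝕜 r)) fun U x O hO hx ↦
      ⟨_, U.opensι ⟨O, hO⟩ ⟨x, hx⟩, isOpenEmb_opensι _ _ _, (range_opensι U _ _).ge hx,
        (range_opensι U _ _).le⟩

theorem isSheafOn_plus_of_isOpenEmbeddingSite {𝕜 : Type} [RCLike 𝕜] {r : WithTop ℕ∞} {C : Type u}
    [Category.{v} C] {ι : C ⥤ Mfd.{t} 𝕜 r} {j : Precoverage C} {E : MorphismProperty C}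
    (h : IsOpenEmbeddingSite j (ι ⋙ toTopCat 𝕜 r) E) (A : Cᵒᵖ ⥤ Type (max u v w)) :
    IsSheafOn j (plus.{u, v, w} j A) := fun U R hR ↦ by
  have : T2Space ((ι ⋙ toTopCat 𝕜 r).obj U) := inferInstanceAs (T2Space (ι.obj U))
  have : ParacompactSpace ((ι ⋙ toTopCat 𝕜 r).obj U) :=
    inferInstanceAs (ParacompactSpace (ι.obj U))
  exact h.isSheafFor_plus A R hR

/-! ### Boxes and good open covers -/

/-- The open box `∏ (aᵢ, bᵢ)` in `ℝⁿ`. -/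
def openBox {n : ℕ} (a b : Fin n → ℝ) : Set (EuclideanSpace ℝ (Fin n)) :=
  {y | ∀ i, y i ∈ Set.Ioo (a i) (b i)}

theorem isOpen_openBox {n : ℕ} (a b : Fin n → ℝ) : IsOpen (openBox a b) := by
  rw [openBox, Set.ofPred_forall]
  exact isOpen_iInter_of_finite fun i ↦ isOpen_Ioo.preimage (by fun_prop)

theorem openBox_inter_openBox {n : ℕ} (a b a' b' : Fin n → ℝ) :
    openBox a b ∩ openBox a' b' = openBox (a ⊔ a') (b ⊓ b') := by
  ext y
  simp only [openBox, Set.mem_inter_iff, Set.mem_ofPred_eq, ← forall_and, ← Set.Ioo_inter_Ioo,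
    Pi.sup_apply, Pi.inf_apply]

theorem exists_openBox_subset {n : ℕ} {x : EuclideanSpace ℝ (Fin n)}
    {O : Set (EuclideanSpace ℝ (Fin n))} (hO : IsOpen O) (hx : x ∈ O) :
    ∃ a b : Fin n → ℝ, x ∈ openBox a b ∧ openBox a b ⊆ O := by
  let e := PiLp.homeomorph 2 (fun _ : Fin n ↦ ℝ)
  obtain ⟨ε, hε, hsub⟩ := Metric.isOpen_iff.1 (e.symm.isOpen_preimage.2 hO) (e x)
    (by simpa using hx)
  refine ⟨fun i ↦ x i - ε, fun i ↦ x i + ε, fun i ↦ by simp [hε], fun y hy ↦ ?_⟩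
  have : e y ∈ Metric.ball (e x) ε := by
    rw [ball_pi _ hε, Set.mem_univ_pi]
    intro i
    rw [Real.ball_eq_Ioo]
    exact hy i
  simpa using hsub this

/-- A nonempty open box is diffeomorphic to `ℝⁿ`, one coordinate at a time. -/
theorem exists_contDiff_openBox {n : ℕ} (a b : Fin n → ℝ) (hab : (openBox a b).Nonempty) :
    ∃ G H : EuclideanSpace ℝ (Fin n) → EuclideanSpace ℝ (Fin n),
      ContDiffOn ℝ ∞ G (openBox a b) ∧ ContDiff ℝ ∞ H ∧ (∀ y, H y ∈ openBox a b) ∧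
      (∀ y, G (H y) = y) ∧ ∀ y ∈ openBox a b, H (G y) = y := by
  obtain ⟨z, hz⟩ := hab
  have hab : ∀ i, 0 < (b i - a i) / 2 := fun i ↦ by
    have := (hz i).1.trans (hz i).2
    linarith
  let u : Fin n → OpenPartialHomeomorph ℝ ℝ := fun i ↦
    OpenPartialHomeomorph.univBall ((a i + b i) / 2) ((b i - a i) / 2)
  have hball : ∀ i, Metric.ball ((a i + b i) / 2) ((b i - a i) / 2) = Set.Ioo (a i) (b i) :=
    fun i ↦ by rw [Real.ball_eq_Ioo]; congr 1 <;> ring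
  have hsource : ∀ i, (u i).source = Set.univ := fun i ↦
    OpenPartialHomeomorph.univBall_source _ _
  have htarget : ∀ i, (u i).target = Set.Ioo (a i) (b i) := fun i ↦
    (OpenPartialHomeomorph.univBall_target _ (hab i)).trans (hball i)
  refine ⟨fun y ↦ WithLp.toLp 2 fun i ↦ (u i).symm (y i), fun y ↦ WithLp.toLp 2 fun i ↦ u i (y i),
    contDiffOn_euclidean.2 fun i ↦ ?_, contDiff_euclidean.2 fun i ↦ ?_, fun y i ↦ ?_, fun y ↦ ?_,
    fun y hy ↦ ?_⟩
  · have h1 : ContDiffOn ℝ ∞ (u i).symm (Set.Ioo (a i) (b i)) :=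
      hball i ▸ OpenPartialHomeomorph.contDiffOn_univBall_symm
    exact h1.comp (s := openBox a b) (f := fun y ↦ y i) (by fun_prop) fun y hy ↦ hy i
  · have h1 : ContDiff ℝ ∞ (u i) := OpenPartialHomeomorph.contDiff_univBall
    exact h1.comp (f := fun y : EuclideanSpace ℝ (Fin n) ↦ y i) (by fun_prop)
  · rw [← htarget]
    exact (u i).map_source (hsource i ▸ Set.mem_univ _)
  · ext i
    exact (u i).left_inv (hsource i ▸ Set.mem_univ _)
  · ext i
    exact (u i).right_inv (htarget i ▸ hy i)

theorem nonempty_diffeomorph_of_eq_preimage_openBox {M : Man.{u}} {n : ℕ}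
    (φ : Diffeomorph M.model (𝓡 n) M (EuclideanSpace ℝ (Fin n)) ∞) (a b : Fin n → ℝ) (W : Opens M)
    (hW : (W : Set M) = φ ⁻¹' openBox a b) (hne : (W : Set M).Nonempty) :
    Nonempty (Diffeomorph M.model (𝓡 n) W (EuclideanSpace ℝ (Fin n)) ∞) := by
  obtain ⟨G, H, hG, hH, hHmem, hGH, hHG⟩ := exists_contDiff_openBox a b (by
    obtain ⟨x, hx⟩ := hne
    exact ⟨φ x, hW.le hx⟩)
  have hWmem : ∀ x : M, x ∈ W ↔ φ x ∈ openBox a b := fun x ↦ Set.ext_iff.1 hW x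
  refine ⟨{ toFun := fun x ↦ G (φ x)
            invFun := fun y ↦ ⟨φ.symm (H y), (hWmem _).2 (by simpa using hHmem y)⟩
            left_inv := fun x ↦ Subtype.ext (by simp [hHG _ ((hWmem _).1 x.2)])
            right_inv := fun y ↦ by simp [hGH]
            contMDiff_toFun := fun x ↦ ?_
            contMDiff_invFun := ?_ }⟩
  · have h1 : ContDiffAt ℝ ∞ G (φ x) :=
      hG.contDiffAt ((isOpen_openBox a b).mem_nhds ((hWmem _).1 x.2))
    exact h1.contMDiffAt.comp (f := fun x : W ↦ φ x) x
      ((φ.contMDiff.comp contMDiff_subtype_val) x)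
  · rw [← ContMDiff.subtypeVal_comp_iff]
    exact φ.symm.contMDiff.comp hH.contMDiff

/-- Inverse images of boxes under a global chart are a basis of a cartesian space. -/
theorem exists_openBox_basis {M : Man.{u}} {n : ℕ}
    (φ : Diffeomorph M.model (𝓡 n) M (EuclideanSpace ℝ (Fin n)) ∞) {x : M} {O : Set M}
    (hO : IsOpen O) (hx : x ∈ O) :
    ∃ (a b : Fin n → ℝ) (W : Opens M), (W : Set M) = φ ⁻¹' openBox a b ∧ x ∈ W ∧
      (W : Set M) ⊆ O := by
  obtain ⟨a, b, hxab, hsub⟩ := exists_openBox_subset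
    (φ.symm.toHomeomorph.isOpen_preimage.2 hO) (x := φ x) (by simpa using hx)
  refine ⟨a, b, ⟨φ ⁻¹' openBox a b, (isOpen_openBox a b).preimage φ.continuous⟩, rfl, hxab, ?_⟩
  intro y hy
  simpa using hsub hy

theorem exists_cart_subset (U : Cart.{u}) {n : ℕ}
    (φ : Diffeomorph U.obj.model (𝓡 n) U.obj (EuclideanSpace ℝ (Fin n)) ∞)
    (x : U.obj) (O : Set U.obj) (hO : IsOpen O) (hx : x ∈ O) :
    ∃ (V : Cart.{u}) (e : V ⟶ U), IsOpenEmb e.hom ∧ x ∈ Set.range (toFun e.hom) ∧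
      Set.range (toFun e.hom) ⊆ O ∧
      ∃ a b : Fin n → ℝ, Set.range (toFun e.hom) = φ ⁻¹' openBox a b := by
  obtain ⟨a, b, W, hW, hxW, hWO⟩ := exists_openBox_basis φ hO hx
  have hV : isCart (U.obj.opens W ⟨x, hxW⟩) :=
    ⟨n, nonempty_diffeomorph_of_eq_preimage_openBox φ a b W hW ⟨x, hxW⟩⟩
  refine ⟨⟨_, hV⟩, ObjectProperty.homMk (U.obj.opensι W ⟨x, hxW⟩), isOpenEmb_opensι _ _ _, ?_⟩
  have : Set.range (toFun (U.obj.opensι W ⟨x, hxW⟩)) = W := range_opensι _ _ _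
  simp only [ObjectProperty.homMk_hom, this]
  exact ⟨hxW, hWO, a, b, hW⟩

theorem isOpenEmbeddingSite_cartOpen :
    IsOpenEmbeddingSite cartOpen.{u} (isCart.ι ⋙ toTopCat ℝ ∞) (fun _ _ f ↦ IsOpenEmb f.hom) :=
  isOpenEmbeddingSite_comap_openFamilies isCart.ι fun U x O hO hx ↦ by
    obtain ⟨n, ⟨φ⟩⟩ := U.property
    obtain ⟨V, e, he, hxe, heO, -⟩ := exists_cart_subset U φ x O hO hx
    exact ⟨V, e, he, hxe, heO⟩

theorem exists_openBox_finset_inf {M : Man.{u}} {n : ℕ}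
    (φ : Diffeomorph M.model (𝓡 n) M (EuclideanSpace ℝ (Fin n)) ∞) (s : Finset (Opens M))
    (hs : s.Nonempty) (h : ∀ W ∈ s, ∃ a b : Fin n → ℝ, (W : Set M) = φ ⁻¹' openBox a b) :
    ∃ a b : Fin n → ℝ, ((s.inf id : Opens M) : Set M) = φ ⁻¹' openBox a b := by
  rw [← Finset.inf'_eq_inf hs]
  refine Finset.inf'_induction hs id
    (p := fun W : Opens M ↦ ∃ a b : Fin n → ℝ, (W : Set M) = φ ⁻¹' openBox a b) ?_ h
  rintro W ⟨a, b, hW⟩ W' ⟨a', b', hW'⟩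
  exact ⟨_, _, by rw [Opens.coe_inf, hW, hW', ← Set.preimage_inter, openBox_inter_openBox]⟩

/-- Covers by inverse images of boxes are good because boxes are stable under intersection. -/
theorem isOpenEmbeddingSite_cartGood :
    IsOpenEmbeddingSite cartGood.{u} (isCart.ι ⋙ toTopCat ℝ ∞) (fun _ _ f ↦ IsOpenEmb f.hom) := by
  refine isOpenEmbeddingSite_of_fullyFaithful isCart.ι cartGood
    isOpenEmbeddingSite_cartOpen.exists_subset (fun U r hr ↦ hr.1) fun {U} S hS ↦ ?_
  obtain ⟨n, ⟨φ⟩⟩ := U.property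
  refine ⟨fun V f ↦ S f ∧ IsOpenEmb f.hom ∧
    ∃ a b : Fin n → ℝ, Set.range (toFun f.hom) = φ ⁻¹' openBox a b, ⟨⟨?_, fun x ↦ ?_⟩, ?_⟩,
    fun V f hf ↦ hf.1⟩
  · rintro _ _ ⟨hf⟩
    exact hf.2.1
  · obtain ⟨V, f, hSf, hf, hx⟩ := hS x
    obtain ⟨W, e, he, hxe, hef, hbox⟩ := exists_cart_subset U φ x _ hf.1.isOpen_range hx
    obtain ⟨k, rfl⟩ := isOpenEmbeddingSite_cartOpen.exists_lift f e hf hef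
    exact ⟨_, _, Presieve.map_map (F := isCart.ι) ⟨S.downward_closed hSf k, he, hbox⟩, hxe⟩
  · intro s hs hsr hne
    obtain ⟨a, b, hab⟩ := exists_openBox_finset_inf φ s hs fun W hW ↦ by
      obtain ⟨V, f, ⟨-, -, a, b, hf⟩, hWf⟩ := hsr W hW
      exact ⟨a, b, hWf.trans hf⟩
    exact ⟨n, nonempty_diffeomorph_of_eq_preimage_openBox φ a b _ hab hne⟩

/-! ### Stein manifolds -/

theorem isClosed_holoHull (M : ComplexMan.{u}) (K : Set M) : IsClosed (holoHull M K) := by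
  have : holoHull M K = ⋂ (f : M → ℂ) (_ : IsHolo M f) (c : ℝ) (_ : ∀ x ∈ K, ‖f x‖ ≤ c),
      {z | ‖f z‖ ≤ c} := by
    ext z
    simp [holoHull]
  rw [this]
  exact isClosed_iInter fun f ↦ isClosed_iInter fun hf ↦ isClosed_iInter fun c ↦
    isClosed_iInter fun _ ↦ isClosed_le hf.continuous.norm continuous_const

/-- A complex manifold that is biholomorphic to a ball in `ℂⁿ` is Stein. -/
theorem isStein_of_range_eq_ball {M : ComplexMan.{u}} {n : ℕ} {c : EuclideanSpace ℂ (Fin n)}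
    {ρ : ℝ} (z : M → EuclideanSpace ℂ (Fin n)) (hz : Topology.IsEmbedding z)
    (hzh : ContMDiff M.model 𝓘(ℂ, EuclideanSpace ℂ (Fin n)) ω z)
    (hρ : 0 < ρ) (hzr : Set.range z = Metric.ball c ρ) : isStein M := by
  refine ⟨fun K hK ↦ ?_, fun x y hxy ↦ ?_⟩
  · have hr : ∃ r, 0 ≤ r ∧ r < ρ ∧ ∀ x ∈ K, ‖z x - c‖ ≤ r := by
      obtain rfl | hne := K.eq_empty_or_nonempty
      · exact ⟨0, le_rfl, hρ, by simp⟩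
      obtain ⟨m, -, hm⟩ := hK.exists_isMaxOn hne
        ((hz.continuous.sub continuous_const).norm.continuousOn (f := fun x ↦ ‖z x - c‖))
      refine ⟨‖z m - c‖, norm_nonneg _, ?_, hm⟩
      rw [← dist_eq_norm, ← Metric.mem_ball, ← hzr]
      exact ⟨m, rfl⟩
    obtain ⟨r, hr0, hrρ, hr⟩ := hr
    have hcomp : IsCompact (z ⁻¹' Metric.closedBall c r) :=
      (hz.isInducing.isCompact_preimage_iff (hzr ▸ Metric.closedBall_subset_ball hrρ)).2
        (isCompact_closedBall c r)
    refine hcomp.of_isClosed_subset (isClosed_holoHull M K) fun x hx ↦ ?_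
    -- The linear form `⟪z x - c, ·⟫` attains its norm in the direction of `z x - c`.
    let l : EuclideanSpace ℂ (Fin n) →L[ℂ] ℂ := innerSL ℂ (z x - c)
    have hl : IsHolo M fun y ↦ l (z y - c) :=
      (l.contDiff.comp (contDiff_id.sub contDiff_const)).contMDiff.comp hzh
    have := hx _ hl (‖z x - c‖ * r) fun y hy ↦
      (norm_inner_le_norm _ _).trans (mul_le_mul_of_nonneg_left (hr y hy) (norm_nonneg _))
    have h2 : ‖z x - c‖ * ‖z x - c‖ ≤ ‖z x - c‖ * r := by
      have h3 : ‖l (z x - c)‖ = ‖z x - c‖ * ‖z x - c‖ := by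
        simp only [l, innerSL_apply_apply]
        rw [inner_self_eq_norm_sq_to_K]
        simp [pow_two]
      exact h3 ▸ this
    rw [Set.mem_preimage, Metric.mem_closedBall, dist_eq_norm]
    by_contra! hlt
    exact absurd h2 (not_le.2 (mul_lt_mul_of_pos_left hlt (hr0.trans_lt hlt)))
  · obtain ⟨i, hi⟩ : ∃ i, z x i ≠ z y i := by
      by_contra! h
      exact hxy (hz.injective (by ext i; exact h i))
    have h1 : ContDiff ℂ ω fun v : EuclideanSpace ℂ (Fin n) ↦ v i := by fun_prop
    exact ⟨fun x ↦ z x i, h1.contMDiff.comp hzh, hi⟩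

/-- Small coordinate balls show that the open Stein submanifolds form a basis. -/
theorem exists_isStein_opens (M : ComplexMan.{u}) (x : M) (O : Set M) (hO : IsOpen O)
    (hx : x ∈ O) : ∃ (W : Opens M) (hxW : x ∈ W), (W : Set M) ⊆ O ∧
      isStein (M.opens W ⟨x, hxW⟩) := by
  let e := chartAt (EuclideanSpace ℂ (Fin M.dim)) x
  have hxe : x ∈ e.source := mem_chart_source _ x
  obtain ⟨ρ, hρ, hball⟩ := Metric.isOpen_iff.1 (e.isOpen_inter_preimage_symm hO) (e x)
    ⟨e.map_source hxe, by simpa [e.left_inv hxe] using hx⟩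
  let W : Opens M := ⟨e.source ∩ e ⁻¹' Metric.ball (e x) ρ,
    e.isOpen_inter_preimage Metric.isOpen_ball⟩
  have hxW : x ∈ W := ⟨hxe, Metric.mem_ball_self hρ⟩
  refine ⟨W, hxW, fun y hy ↦ ?_, ?_⟩
  · have := (hball hy.2).2
    rwa [Set.mem_preimage, e.left_inv hy.1] at this
  · refine isStein_of_range_eq_ball (M := M.opens W ⟨x, hxW⟩) (c := e x) (ρ := ρ)
      (fun y : W ↦ e y.1) ?_ ?_ hρ ?_
    · exact e.isOpenEmbedding_restrict.isEmbedding.comp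
        (Topology.IsEmbedding.inclusion (fun y hy ↦ hy.1 : (W : Set M) ⊆ e.source))
    · have h1 : ContMDiffOn M.model M.model ω e e.source := contMDiffOn_chart
      have h2 : ContMDiff M.model M.model ω (Subtype.val : W → M) := contMDiff_subtype_val
      exact h1.comp_contMDiff h2 fun y ↦ y.2.1
    · ext y
      constructor
      · rintro ⟨w, rfl⟩
        exact w.2.2
      · intro hy
        have hyt := (hball hy).1
        exact ⟨⟨e.symm y, e.map_target hyt, by simpa [e.right_inv hyt] using hy⟩, e.right_inv hyt⟩

theorem isOpenEmbeddingSite_steinOpen :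
    IsOpenEmbeddingSite steinOpen.{u} (isStein.ι ⋙ toTopCat ℂ ω) (fun _ _ f ↦ IsOpenEmb f.hom) :=
  isOpenEmbeddingSite_comap_openFamilies isStein.ι fun U x O hO hx ↦ by
    obtain ⟨W, hxW, hWO, hW⟩ := exists_isStein_opens U.obj x O hO hx
    exact ⟨⟨_, hW⟩, ObjectProperty.homMk (U.obj.opensι W ⟨x, hxW⟩), isOpenEmb_opensι _ _ _,
      (range_opensι _ _ _).ge hxW, (range_opensι _ _ _).le.trans hWO⟩

end PlusSites

end

theorem mainTheorem2 :
    -- topological manifolds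
    (∀ A : PlusSites.TopMan.{u}ᵒᵖ ⥤ Type (max (u + 1) w),
      PlusSites.IsSheafOn PlusSites.topManOpen (PlusSites.plus.{u + 1, u, w} PlusSites.topManOpen A)) ∧
    -- open subsets of a paracompact Hausdorff space of finite covering dimension
    (∀ (X : Type u) [TopologicalSpace X] [T2Space X] [ParacompactSpace X],
      PlusSites.HasFiniteCoveringDim X →
      ∀ A : (PlusSites.NonemptyOpens X)ᵒᵖ ⥤ Type (max u w),
        (∀ U : PlusSites.NonemptyOpens X, ParacompactSpace U.1 →
          ∀ r ∈ PlusSites.openCovers X U,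
            Presieve.IsSheafFor (PlusSites.plus.{u, u, w} (PlusSites.openCovers X) A) r) ∧
        ((∀ U : Opens X, ParacompactSpace U) →
          PlusSites.IsSheafOn (PlusSites.openCovers X)
            (PlusSites.plus.{u, u, w} (PlusSites.openCovers X) A))) ∧
    -- smooth manifolds
    (∀ A : PlusSites.Man.{u}ᵒᵖ ⥤ Type (max (u + 1) w),
      PlusSites.IsSheafOn (PlusSites.Mfd.openFamilies ℝ ∞)
        (PlusSites.plus.{u + 1, u, w} (PlusSites.Mfd.openFamilies ℝ ∞) A)) ∧
    -- cartesian spaces with open covers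
    (∀ A : PlusSites.Cart.{u}ᵒᵖ ⥤ Type (max (u + 1) w),
      PlusSites.IsSheafOn PlusSites.cartOpen (PlusSites.plus.{u + 1, u, w} PlusSites.cartOpen A)) ∧
    -- cartesian spaces with good open covers
    (∀ A : PlusSites.Cart.{u}ᵒᵖ ⥤ Type (max (u + 1) w),
      PlusSites.IsSheafOn PlusSites.cartGood (PlusSites.plus.{u + 1, u, w} PlusSites.cartGood A)) ∧
    -- complex manifolds
    (∀ A : PlusSites.ComplexMan.{u}ᵒᵖ ⥤ Type (max (u + 1) w),
      PlusSites.IsSheafOn (PlusSites.Mfd.openFamilies ℂ ω)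
        (PlusSites.plus.{u + 1, u, w} (PlusSites.Mfd.openFamilies ℂ ω) A)) ∧
    -- Stein manifolds
    (∀ A : PlusSites.Stein.{u}ᵒᵖ ⥤ Type (max (u + 1) w),
      PlusSites.IsSheafOn PlusSites.steinOpen
        (PlusSites.plus.{u + 1, u, w} PlusSites.steinOpen A)) := by
  refine ⟨fun A U r hr ↦ ?_, fun X _ _ _ _ A ↦ ?_, ?_, ?_, ?_, ?_, ?_⟩
  · have : T2Space (PlusSites.isTopMan.ι.obj U) := U.property.2.1
    have : ParacompactSpace (PlusSites.isTopMan.ι.obj U) :=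
      PlusSites.paracompactSpace_of_isTopMan U.property
    exact PlusSites.isOpenEmbeddingSite_topMan.isSheafFor_plus A r hr
  · have key (U : PlusSites.NonemptyOpens X) (hU : ParacompactSpace U.1) (r : Presieve U)
        (hr : r ∈ PlusSites.openCovers X U) :
        Presieve.IsSheafFor (PlusSites.plus.{u, u, w} (PlusSites.openCovers X) A) r := by
      have : T2Space ((PlusSites.nonemptyOpensToTopCat X).obj U) := inferInstanceAs (T2Space U.1)
      have : ParacompactSpace ((PlusSites.nonemptyOpensToTopCat X).obj U) := hU
      exact (PlusSites.isOpenEmbeddingSite_nonemptyOpens X).isSheafFor_plus A r hr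
    exact ⟨key, fun h U r hr ↦ key U (h U.1) r hr⟩
  · exact PlusSites.isSheafOn_plus_of_isOpenEmbeddingSite
      (PlusSites.isOpenEmbeddingSite_openFamilies ℝ ∞)
  · exact PlusSites.isSheafOn_plus_of_isOpenEmbeddingSite PlusSites.isOpenEmbeddingSite_cartOpen
  · exact PlusSites.isSheafOn_plus_of_isOpenEmbeddingSite PlusSites.isOpenEmbeddingSite_cartGood
  · exact PlusSites.isSheafOn_plus_of_isOpenEmbeddingSite
      (PlusSites.isOpenEmbeddingSite_openFamilies ℂ ω)
  · exact PlusSites.isSheafOn_plus_of_isOpenEmbeddingSite PlusSites.isOpenEmbeddingSite_steinOpen
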